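/- Let $(X_t)_{t\ge 0}$ and $(Y_t)_{t\ge 0}$ be independent real-valued Lévy processes (started at $0$, with stationary independent increments and almost surely càdlàg paths) on a common probability space, with $X_1$ and $Y_1$ integrable. Put $m_X=\mathbb{E}X_1$, $m_Y=\mathbb{E}Y_1$ and suppose $m_X>0$. Let $Z_t=X_t-Y_t$, let $$V_t=X_t-\inf_{0\le s\le t}Z_s=Z_t-\inf_{0\le s\le t}Z_s+Y_t$$ be the process $X$ reflected at the barrier $Y$, and for $u\in\mathbb{R}$ let $\tau(u)=\inf\{t\ge 0: V_t>u\}$ (with $\inf\emptyset=\infty$). (i) If $\mathbb{E}Z_1>0$, then each $\tau(u)$ is an almost surely finite random variable (measurable up to a null set) and, as $u\to\infty$, $$\frac{\tau(u)}{u}\to\frac1{m_X}\ \text{ in probability;}$$ if moreover $\omega_X^2=\operatorname{Var}(X_1)<\infty$, then $$\frac{\tau(u)-u/m_X}{\sqrt u}\Rightarrow N\!\left(0,\frac{\omega_X^2}{m_X^3}\right)\ \text{ in distribution.}$$ (ii) If $\mathbb{E}Z_1<0$, then each $\tau(u)$ is an almost surely finite random variable (measurable up to a null set) and, as $u\to\infty$,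 $$\frac{\tau(u)}{u}\to\frac1{m_Y}\ \text{ in probability;}$$ if moreover $\omega_Y^2=\operatorname{Var}(Y_1)<\infty$, then $$\frac{\tau(u)-u/m_Y}{\sqrt u}\Rightarrow N\!\left(0,\frac{\omega_Y^2}{m_Y^3}\right)\ \text{ in distribution.}$$ Here $N(0,0)$ is the unit point mass at $0$. -/

import Mathlib

open MeasureTheory ProbabilityTheory Filter Topology
open scoped NNReal ENNReal

/-- A real path on `[0, ∞)` is càdlàg: right-continuous with (finite) left limits. -/
def IsCadlagPath (f : ℝ≥0 → ℝ) : Prop :=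
  ∀ t : ℝ≥0, ContinuousWithinAt f (Set.Ioi t) t ∧ ∃ l : ℝ, Tendsto f (𝓝[<] t) (𝓝 l)

/-- A real Lévy process: it starts at zero, has independent and stationary increments, and
almost all its paths are càdlàg. (Stochastic continuity follows from these properties.) -/
structure IsLevyProcess {Ω : Type*} [MeasurableSpace Ω] (X : ℝ≥0 → Ω → ℝ) (P : Measure Ω) :
    Prop where
  measurable : ∀ t, Measurable (X t)
  zero : ∀ᵐ ω ∂P, X 0 ω = 0
  indep_increments : HasIndepIncrements X P
  stationary_increments : ∀ s t : ℝ≥0, IdentDistrib (fun ω ↦ X (s + t) ω - X s ω) (X t) P P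
  cadlag : ∀ᵐ ω ∂P, IsCadlagPath (fun t ↦ X t ω)

/-- The process `X` reflected at the barrier `Y`: with `Z = X - Y`,
`V t = X t - inf_{0 ≤ s ≤ t} Z s`, that is `V t = Z t - inf_{0 ≤ s ≤ t} Z s + Y t`.
The infimum is over a set of reals that is bounded below whenever the paths are càdlàg. -/
noncomputable def reflectedProcess {Ω : Type*} (X Y : ℝ≥0 → Ω → ℝ) (t : ℝ≥0) (ω : Ω) : ℝ :=
  X t ω - ⨅ s : Set.Iic t, (X s ω - Y s ω)

/-- The first passage time `inf {t ≥ 0 : V t > u}`, equal to `∞` if the level `u` is never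
exceeded. -/
noncomputable def firstPassageTime {Ω : Type*} (V : ℝ≥0 → Ω → ℝ) (u : ℝ) : Ω → ℝ≥0∞ :=
  hittingAfter V (Set.Ioi u) 0

/-! Almost surely `V t` is the supremum over `r ≤ t` of `X t - Z r`. Taking `r = 0` gives `V ≥ X`,
and `r = t` gives `V ≥ Y`. Let `W` be `X` when `Z` has positive mean and `Y` when it has negative
mean. Then `W` is the dominant lower bound: if `X s - Z r > u` for some `r ≤ s < n`, then `W n`
exceeds `u` up to an error that is tight uniformly in `n` and `u`. The error consists of a drop of
`X` after `s`, together with the infimum of `Z` (first case) or a drop of `-Z` after `r` (second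
case). `IsApproxPassageTime` records these two facts, and only integer times of `W` matter from
there on.

The limit theorems follow by inversion: up to `ε`, the probability of `τ u ≤ t` lies between that of
`W ⌊t⌋ > u` and that of `W (⌊t⌋ + 1) > u - K`. The law of large numbers and the central limit
theorem for the i.i.d. unit increments of `W` decide both bounds, since the constant `K` vanishes at
scale `√u`.

Tightness is `IsLevyProcess.exists_measureReal_exists_lt_le`, for Lévy processes with positive mean.
The strong law bounds the infimum over integer times, an Ottaviani argument passes to dyadic grids,
right continuity to all times, and time reversal turns the infimum of the path into its largest drop
before `n`. -/

/-- Probability measures on `ℝ` converge weakly as soon as their distribution functions converge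
at the points of a dense set. -/
theorem tendsto_probabilityMeasure_of_tendsto_Iic {ι : Type*} {l : Filter ι}
    [l.IsCountablyGenerated] {μ : ι → ProbabilityMeasure ℝ} {ν : ProbabilityMeasure ℝ}
    {D : Set ℝ} (hD : Dense D)
    (h : ∀ x ∈ D, Tendsto (fun i ↦ (μ i : Measure ℝ).real (Set.Iic x)) l
      (𝓝 ((ν : Measure ℝ).real (Set.Iic x)))) :
    Tendsto μ l (𝓝 ν) := by
  -- Half-open intervals with endpoints in `D` form a π-system containing small neighbourhoods of
  -- every point, and their masses are differences of distribution functions.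
  have hS : IsPiSystem {s : Set ℝ | ∃ a ∈ D, ∃ b ∈ D, a ≤ b ∧ s = Set.Ioc a b} := by
    rintro _ ⟨a, ha, b, hb, -, rfl⟩ _ ⟨c, hc, d, hd, -, rfl⟩ hne
    rw [Set.Ioc_inter_Ioc] at hne ⊢
    refine ⟨a ⊔ c, ?_, b ⊓ d, ?_, ?_, rfl⟩
    · rcases max_choice a c with h | h <;> rw [h] <;> assumption
    · rcases min_choice b d with h | h <;> rw [h] <;> assumption
    · exact (Set.nonempty_Ioc.1 hne).le
  refine hS.tendsto_probabilityMeasure_of_tendsto_of_mem ?_ ?_ ?_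
  · rintro _ ⟨a, -, b, -, -, rfl⟩
    exact measurableSet_Ioc
  · intro u hu x hx
    obtain ⟨a, b, ⟨hxa, hxb⟩, hab⟩ := mem_nhds_iff_exists_Ioo_subset.1 (hu.mem_nhds hx)
    obtain ⟨a', ha', h1, h2⟩ := hD.exists_between hxa
    obtain ⟨b', hb', h3, h4⟩ := hD.exists_between hxb
    exact ⟨Set.Ioc a' b', ⟨a', ha', b', hb', (h2.trans h3).le, rfl⟩, Ioc_mem_nhds h2 h3,
      fun y hy ↦ hab ⟨h1.trans hy.1, hy.2.trans_lt h4⟩⟩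
  · rintro _ ⟨a, ha, b, hb, hab, rfl⟩
    have key : ∀ ρ : ProbabilityMeasure ℝ, (ρ : Measure ℝ).real (Set.Ioc a b) =
        (ρ : Measure ℝ).real (Set.Iic b) - (ρ : Measure ℝ).real (Set.Iic a) := by
      intro ρ
      rw [← Set.Iic_sdiff_Iic, measureReal_sdiff (Set.Iic_subset_Iic.2 hab) measurableSet_Iic]
    have h3 := (h b hb).sub (h a ha)
    simp only [← key] at h3
    rw [← NNReal.tendsto_coe]
    exact h3

/-! ### Random sequences at moving indices and thresholds -/

section RandomSequence

variable {Ω : Type*} [MeasurableSpace Ω] {P : Measure Ω} [IsProbabilityMeasure P]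
  {S : ℕ → Ω → ℝ} {m : ℝ}

theorem tendsto_measureReal_lt_zero_of_tendstoInMeasure
    (hS : TendstoInMeasure P (fun n ω ↦ S n ω / n) atTop (fun _ ↦ m))
    {n : ℝ → ℕ} {y : ℝ → ℝ} {η : ℝ} (hη : 0 < η) (hn : Tendsto n atTop atTop)
    (hy : ∀ᶠ u in atTop, (m + η) * n u ≤ y u) :
    Tendsto (fun u ↦ P.real {ω | y u < S (n u) ω}) atTop (𝓝 0) := by
  have h1 := (tendstoInMeasure_iff_measureReal_norm.1 (hS.comp hn)) η hη
  refine squeeze_zero' (.of_forall fun _ ↦ measureReal_nonneg) ?_ h1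
  filter_upwards [hy, hn.eventually_gt_atTop 0] with u hu hpos
  refine measureReal_mono fun ω hω ↦ ?_
  have hpos' : (0 : ℝ) < n u := by exact_mod_cast hpos
  simp only [Set.mem_ofPred_eq, Function.comp_apply, Real.norm_eq_abs] at hω ⊢
  refine le_trans ?_ (le_abs_self _)
  rw [le_sub_iff_add_le, le_div_iff₀ hpos']
  linarith

theorem tendsto_measureReal_le_zero_of_tendstoInMeasure
    (hS : TendstoInMeasure P (fun n ω ↦ S n ω / n) atTop (fun _ ↦ m))
    {n : ℝ → ℕ} {y : ℝ → ℝ} {η : ℝ} (hη : 0 < η) (hn : Tendsto n atTop atTop)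
    (hy : ∀ᶠ u in atTop, y u ≤ (m - η) * n u) :
    Tendsto (fun u ↦ P.real {ω | S (n u) ω ≤ y u}) atTop (𝓝 0) := by
  have h1 := (tendstoInMeasure_iff_measureReal_norm.1 (hS.comp hn)) η hη
  refine squeeze_zero' (.of_forall fun _ ↦ measureReal_nonneg) ?_ h1
  filter_upwards [hy, hn.eventually_gt_atTop 0] with u hu hpos
  refine measureReal_mono fun ω hω ↦ ?_
  have hpos' : (0 : ℝ) < n u := by exact_mod_cast hpos
  simp only [Set.mem_ofPred_eq, Function.comp_apply, Real.norm_eq_abs] at hω ⊢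
  rw [abs_sub_comm]
  refine le_trans ?_ (le_abs_self _)
  rw [le_sub_comm, div_le_iff₀ hpos']
  linarith

/-- Slutsky: the standardised threshold converges to the constant `c`, so it can be subtracted
inside the limit law. The absence of an atom at `c` makes the boundary of the half-line null. -/
theorem tendsto_measureReal_lt_of_tendstoInDistribution {ν : Measure ℝ} [IsProbabilityMeasure ν]
    (hclt : TendstoInDistribution (fun (n : ℕ) ω ↦ (√n)⁻¹ * (S n ω - n * m)) atTop
      (id : ℝ → ℝ) (fun _ ↦ P) ν)
    {n : ℝ → ℕ} {y : ℝ → ℝ} {c : ℝ} (hn : Tendsto n atTop atTop)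
    (hy : Tendsto (fun u ↦ (√(n u))⁻¹ * (y u - n u * m)) atTop (𝓝 c)) (hc : ν {c} = 0) :
    Tendsto (fun u ↦ P.real {ω | y u < S (n u) ω}) atTop (𝓝 (ν.real (Set.Ioi c))) := by
  have h1 : TendstoInDistribution (fun (u : ℝ) ω ↦ (√(n u))⁻¹ * (S (n u) ω - n u * m)) atTop
      (id : ℝ → ℝ) (fun _ ↦ P) ν :=
    ⟨fun u ↦ hclt.forall_aemeasurable (n u), hclt.aemeasurable_limit, hclt.tendsto.comp hn⟩
  have h2 : TendstoInMeasure P (fun (u : ℝ) (_ : Ω) ↦ -((√(n u))⁻¹ * (y u - n u * m))) atTop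
      (fun _ ↦ -c) := by
    rw [tendstoInMeasure_iff_norm]
    intro ε hε
    refine tendsto_const_nhds.congr' ?_
    filter_upwards [Metric.tendsto_nhds.1 hy.neg ε hε] with u hu
    rw [Real.dist_eq] at hu
    simp only [Real.norm_eq_abs, not_le.2 hu]
    simp
  have h3 := h1.add_of_tendstoInMeasure_const h2 (fun _ ↦ aemeasurable_const)
  have hmap : (ν.map (fun ω ↦ id ω + -c)) (frontier (Set.Ioi 0)) = 0 := by
    rw [frontier_Ioi, Measure.map_apply (by fun_prop) (measurableSet_singleton _)]
    convert hc using 2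
    ext x
    simp [← sub_eq_add_neg, sub_eq_zero]
  have h4 := ProbabilityMeasure.tendsto_measure_of_null_frontier_of_tendsto' h3.tendsto
    (E := Set.Ioi 0) hmap
  have h5 := (ENNReal.tendsto_toReal ?_).comp h4
  swap
  · exact (measure_lt_top (ν.map (fun ω ↦ id ω + -c)) _).ne
  have e1 : ν.real (Set.Ioi c) = ((ν.map (fun ω ↦ id ω + -c)) (Set.Ioi 0)).toReal := by
    rw [Measure.map_apply (by fun_prop) measurableSet_Ioi, measureReal_def]
    congr 2
    ext x
    simp [← sub_eq_add_neg]
  rw [e1]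
  refine h5.congr' ?_
  filter_upwards [hn.eventually_gt_atTop 0] with u hu
  have hpos : (0 : ℝ) < (√(n u))⁻¹ := by
    have : (0 : ℝ) < n u := by exact_mod_cast hu
    positivity
  simp only [Function.comp_apply, ProbabilityMeasure.coe_mk]
  rw [Measure.map_apply_of_aemeasurable (h3.forall_aemeasurable u) measurableSet_Ioi,
    measureReal_def]
  congr 2
  ext ω
  simp only [Set.mem_preimage, Pi.add_apply, Set.mem_Ioi, Set.mem_ofPred_eq]
  rw [← sub_eq_add_neg, ← mul_sub, mul_pos_iff_of_pos_left hpos]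
  constructor <;> intro h <;> linarith

end RandomSequence

/-! ### Inversion: from limit theorems for `S` to limit theorems for `τ` -/

section Passage

variable {Ω : Type*} [MeasurableSpace Ω] {P : Measure Ω} [IsProbabilityMeasure P]
  {S : ℕ → Ω → ℝ} {m : ℝ} {τ : ℝ → Ω → ℝ≥0∞}

/-- The family `τ u` approximates the first passage times of the sequence `S`: it is bounded above
by the latter, and the values of `S` at times after `τ u` exceed `u` up to a tight error. -/
structure IsApproxPassageTime (S : ℕ → Ω → ℝ) (τ : ℝ → Ω → ℝ≥0∞) (P : Measure Ω) : Prop where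
  le_of_lt : ∀ᵐ ω ∂P, ∀ (u : ℝ) (n : ℕ), u < S n ω → τ u ω ≤ n
  tight : ∀ ε : ℝ, 0 < ε → ∃ K : ℝ, ∀ (n : ℕ) (u : ℝ), P.real {ω | τ u ω < n ∧ S n ω ≤ u - K} ≤ ε

namespace IsApproxPassageTime

omit [IsProbabilityMeasure P] in
theorem ae_lt_top (h : IsApproxPassageTime S τ P) (hm : 0 < m)
    (hlln : ∀ᵐ ω ∂P, Tendsto (fun n : ℕ ↦ S n ω / n) atTop (𝓝 m)) :
    ∀ᵐ ω ∂P, ∀ u, τ u ω < ∞ := by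
  filter_upwards [h.le_of_lt, hlln] with ω h1 h2 u
  have h3 : Tendsto (fun n : ℕ ↦ S n ω / n * n) atTop atTop :=
    h2.pos_mul_atTop hm tendsto_natCast_atTop_atTop
  obtain ⟨n, hn, hn'⟩ := ((h3.eventually_gt_atTop u).and (eventually_gt_atTop 0)).exists
  have : (n : ℝ) ≠ 0 := by exact_mod_cast hn'.ne'
  rw [div_mul_cancel₀ _ this] at hn
  exact (h1 u n hn).trans_lt (ENNReal.natCast_lt_top n)

/-- If `τ u ≤ t < n`, either `S n` is above `u - K` or the exceptional event of `tight` occurs.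
Finiteness is needed because `toReal` sends `∞` to `0`. -/
theorem measureReal_toReal_le (h : IsApproxPassageTime S τ P)
    (hfin : ∀ᵐ ω ∂P, ∀ u, τ u ω < ∞) {ε : ℝ} (hε : 0 < ε) :
    ∃ K : ℝ, ∀ (n : ℕ) (u t : ℝ), t < n →
      P.real {ω | (τ u ω).toReal ≤ t} ≤ P.real {ω | u - K < S n ω} + ε := by
  obtain ⟨K, hK⟩ := h.tight ε hε
  refine ⟨K, fun n u t ht ↦ ?_⟩
  have h1 : P.real {ω | (τ u ω).toReal ≤ t} ≤
      P.real ({ω | u - K < S n ω} ∪ {ω | τ u ω < n ∧ S n ω ≤ u - K}) := by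
    refine ENNReal.toReal_mono (measure_ne_top _ _) (measure_mono_ae ?_)
    filter_upwards [hfin] with ω hω hle
    by_cases hS : u - K < S n ω
    · exact Or.inl hS
    · refine Or.inr ⟨?_, not_lt.1 hS⟩
      rw [← ENNReal.ofReal_toReal (hω u).ne, ← ENNReal.ofReal_natCast]
      have hle' : (τ u ω).toReal ≤ t := hle
      refine (ENNReal.ofReal_lt_ofReal_iff_of_nonneg ENNReal.toReal_nonneg).2 (hle'.trans_lt ht)
  exact h1.trans ((measureReal_union_le _ _).trans (by gcongr; exact hK n u))

theorem measureReal_lt_le (h : IsApproxPassageTime S τ P) (n : ℕ) {u t : ℝ} (ht : (n : ℝ) ≤ t) :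
    P.real {ω | u < S n ω} ≤ P.real {ω | (τ u ω).toReal ≤ t} := by
  refine ENNReal.toReal_mono (measure_ne_top _ _) (measure_mono_ae ?_)
  filter_upwards [h.le_of_lt] with ω hω hu
  refine le_trans ?_ ht
  exact ENNReal.toReal_le_of_le_ofReal (by positivity) (by simpa using hω u n hu)

theorem measureReal_lt_toReal_le (h : IsApproxPassageTime S τ P) (n : ℕ) {u t : ℝ}
    (ht : (n : ℝ) < t) :
    P.real {ω | t ≤ (τ u ω).toReal} ≤ P.real {ω | S n ω ≤ u} := by
  refine ENNReal.toReal_mono (measure_ne_top _ _) (measure_mono_ae ?_)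
  filter_upwards [h.le_of_lt] with ω hω hu
  by_contra hlt
  have h1 : (τ u ω).toReal ≤ n :=
    ENNReal.toReal_le_of_le_ofReal (by positivity) (by simpa using hω u n (not_le.1 hlt))
  have hu' : t ≤ (τ u ω).toReal := hu
  linarith

theorem tendstoInMeasure_div (h : IsApproxPassageTime S τ P) (hm : 0 < m)
    (hS : ∀ n, AEMeasurable (S n) P)
    (hlln : ∀ᵐ ω ∂P, Tendsto (fun n : ℕ ↦ S n ω / n) atTop (𝓝 m)) :
    TendstoInMeasure P (fun (u : ℝ) ω ↦ (τ u ω).toReal / u) atTop (fun _ ↦ 1 / m) := by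
  have hfin := h.ae_lt_top hm hlln
  have hlln' : TendstoInMeasure P (fun n ω ↦ S n ω / n) atTop (fun _ ↦ m) :=
    tendstoInMeasure_of_tendsto_ae (fun n ↦ ((hS n).div_const _).aestronglyMeasurable) hlln
  rw [tendstoInMeasure_iff_measureReal_norm]
  intro δ₀ hδ₀
  -- Shrinking `δ₀` only enlarges the event; `δ < 1 / m` keeps the lower time `u * (1 / m - δ)`
  -- positive.
  obtain ⟨δ, hδ, hδδ₀, hδm⟩ : ∃ δ > 0, δ ≤ δ₀ ∧ δ < 1 / m :=
    ⟨min δ₀ (1 / (2 * m)), by positivity, min_le_left _ _,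
      (min_le_right _ _).trans_lt (by gcongr; linarith)⟩
  have hb : 0 < 1 / m - δ := by linarith
  have hlow : Tendsto (fun u ↦ P.real {ω | (τ u ω).toReal ≤ u * (1 / m - δ)}) atTop (𝓝 0) := by
    rw [Metric.tendsto_nhds]
    intro ε hε
    obtain ⟨K, hK⟩ := h.measureReal_toReal_le hfin (half_pos hε)
    set n : ℝ → ℕ := fun u ↦ ⌊u * (1 / m - δ)⌋₊ + 1 with hn_def
    have hn : Tendsto n atTop atTop :=
      (tendsto_add_atTop_nat 1).comp (tendsto_nat_floor_atTop.comp
        (tendsto_id.atTop_mul_const hb))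
    have hmδ : (1 / m - δ) * m = 1 - δ * m := by field_simp
    -- This `η` makes the product equal to `1 - δ * m / 2`, leaving linear room in `u` for `K` and
    -- the rounding.
    obtain ⟨η, hη, hη1⟩ : ∃ η > 0, (m + η) * (1 / m - δ) < 1 := by
      refine ⟨δ * m / (2 * (1 / m - δ)), by positivity, ?_⟩
      have : (m + δ * m / (2 * (1 / m - δ))) * (1 / m - δ) = (1 / m - δ) * m + δ * m / 2 := by
        generalize 1 / m - δ = b at hb
        field_simp
      rw [this, hmδ]
      nlinarith [mul_pos hδ hm]
    have h1 : Tendsto (fun u ↦ P.real {ω | u - K < S (n u) ω}) atTop (𝓝 0) := by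
      refine tendsto_measureReal_lt_zero_of_tendstoInMeasure hlln' hη hn ?_
      have h2 : Tendsto (fun u : ℝ ↦ u * (1 - (m + η) * (1 / m - δ))) atTop atTop :=
        tendsto_id.atTop_mul_const (by linarith)
      filter_upwards [h2.eventually_ge_atTop (K + (m + η)), eventually_ge_atTop 0] with u hu hu0
      have h3 : (n u : ℝ) ≤ u * (1 / m - δ) + 1 := by
        simp only [hn_def, Nat.cast_add, Nat.cast_one]
        gcongr
        exact Nat.floor_le (by positivity)
      have h4 : (m + η) * n u ≤ (m + η) * (u * (1 / m - δ) + 1) := by gcongr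
      linarith
    filter_upwards [(tendsto_order.1 h1).2 _ (half_pos hε)] with u hu
    rw [Real.dist_eq, sub_zero, abs_of_nonneg measureReal_nonneg]
    have := hK (n u) u (u * (1 / m - δ)) (by simpa [hn_def] using Nat.lt_floor_add_one _)
    linarith
  have hup : Tendsto (fun u ↦ P.real {ω | u * (1 / m + δ) ≤ (τ u ω).toReal}) atTop (𝓝 0) := by
    -- Half of `δ` is kept back so that `n u` is strictly below `u * (1 / m + δ)`.
    set n : ℝ → ℕ := fun u ↦ ⌊u * (1 / m + δ / 2)⌋₊ with hn_def
    have ha2 : 0 < 1 / m + δ / 2 := by positivity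
    have hn : Tendsto n atTop atTop :=
      tendsto_nat_floor_atTop.comp (tendsto_id.atTop_mul_const ha2)
    have hmδ : (1 / m + δ / 2) * m = 1 + δ * m / 2 := by field_simp
    obtain ⟨η, hη, hη1, hηm⟩ : ∃ η > 0, 1 < (m - η) * (1 / m + δ / 2) ∧ 0 < m - η := by
      have hpos : 0 < δ * m / (4 * (1 / m + δ / 2)) := by positivity
      have : (m - δ * m / (4 * (1 / m + δ / 2))) * (1 / m + δ / 2)
          = (1 / m + δ / 2) * m - δ * m / 4 := by
        generalize 1 / m + δ / 2 = b at ha2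
        field_simp
      have h1 : 1 < (m - δ * m / (4 * (1 / m + δ / 2))) * (1 / m + δ / 2) := by
        rw [this, hmδ]
        nlinarith [mul_pos hδ hm]
      exact ⟨_, hpos, h1, pos_of_mul_pos_left (by linarith) ha2.le⟩
    have h1 : Tendsto (fun u ↦ P.real {ω | S (n u) ω ≤ u}) atTop (𝓝 0) := by
      refine tendsto_measureReal_le_zero_of_tendstoInMeasure hlln' hη hn ?_
      have h2 : Tendsto (fun u : ℝ ↦ u * ((m - η) * (1 / m + δ / 2) - 1)) atTop atTop :=
        tendsto_id.atTop_mul_const (by linarith)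
      filter_upwards [h2.eventually_ge_atTop (m - η)] with u hu
      have h3 : u * (1 / m + δ / 2) - 1 ≤ n u := (Nat.sub_one_lt_floor _).le
      have h4 : (m - η) * (u * (1 / m + δ / 2) - 1) ≤ (m - η) * n u := by gcongr
      linarith
    refine squeeze_zero' (.of_forall fun _ ↦ measureReal_nonneg) ?_ h1
    filter_upwards [eventually_gt_atTop 0] with u hu
    refine h.measureReal_lt_toReal_le (n u) ?_
    calc (n u : ℝ) ≤ u * (1 / m + δ / 2) := Nat.floor_le (by positivity)
      _ < u * (1 / m + δ) := by gcongr; linarith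
  have hsum := hlow.add hup
  rw [add_zero] at hsum
  refine squeeze_zero' (.of_forall fun _ ↦ measureReal_nonneg) ?_ hsum
  filter_upwards [eventually_gt_atTop 0] with u hu
  refine (measureReal_mono ?_).trans (measureReal_union_le _ _)
  intro ω hω
  have hω' : δ ≤ |(τ u ω).toReal / u - 1 / m| := hδδ₀.trans hω
  rcases le_abs'.1 hω' with h1 | h1
  · left
    have : (τ u ω).toReal / u ≤ 1 / m - δ := by linarith
    rw [div_le_iff₀ hu] at this
    simpa [mul_comm] using this
  · right
    have : 1 / m + δ ≤ (τ u ω).toReal / u := by linarith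
    rw [le_div_iff₀ hu] at this
    simpa [mul_comm] using this

/-- The event `τ u ≤ t` is squeezed between passage of `S` at index `⌊t⌋` with threshold `u` and at
index `⌊t⌋ + 1` with threshold `u - K`; both bounds have the same limit, up to an arbitrary `ε`. -/
theorem tendsto_measureReal_le (h : IsApproxPassageTime S τ P) (hm : 0 < m)
    (hfin : ∀ᵐ ω ∂P, ∀ u, τ u ω < ∞)
    {ν : Measure ℝ} [IsProbabilityMeasure ν]
    (hclt : TendstoInDistribution (fun (n : ℕ) ω ↦ (√n)⁻¹ * (S n ω - n * m)) atTop
      (id : ℝ → ℝ) (fun _ ↦ P) ν) {x : ℝ} (hx : ν {-(x * (m * √m))} = 0) :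
    Tendsto (fun u ↦ P.real {ω | (τ u ω).toReal ≤ u / m + x * √u}) atTop
      (𝓝 (ν.real (Set.Ioi (-(x * (m * √m)))))) := by
  set t : ℝ → ℝ := fun u ↦ u / m + x * √u with ht
  have hsqrt : Tendsto (fun u : ℝ ↦ (√u)⁻¹) atTop (𝓝 0) :=
    tendsto_inv_atTop_zero.comp Real.tendsto_sqrt_atTop
  have htu : Tendsto (fun u ↦ t u / u) atTop (𝓝 (1 / m)) := by
    have h1 : Tendsto (fun u ↦ 1 / m + x * (√u)⁻¹) atTop (𝓝 (1 / m + x * 0)) :=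
      tendsto_const_nhds.add (tendsto_const_nhds.mul hsqrt)
    rw [mul_zero, add_zero] at h1
    refine h1.congr' ?_
    filter_upwards [eventually_gt_atTop 0] with u hu
    have h2 : √u * √u = u := Real.mul_self_sqrt hu.le
    have h3 : 0 < √u := Real.sqrt_pos.2 hu
    simp only [ht]
    have h4 : (√u)⁻¹ = √u / u := by
      rw [inv_eq_one_div, div_eq_div_iff h3.ne' hu.ne', h2, one_mul]
    rw [h4]
    field_simp
  have htop : Tendsto t atTop atTop := by
    refine (htu.pos_mul_atTop (by positivity) tendsto_id).congr' ?_
    filter_upwards [eventually_gt_atTop 0] with u hu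
    simp [hu.ne']
  -- Since `u - t u * m = -(x * m * √u)` and `n u ~ u / m`, normalising by `√(n u)` gives `-(x * m *
  -- √m)`. The shift `K` and the rounding contribute at most `|K| + m`, negligible against `√u`.
  have hkey : ∀ (n : ℝ → ℕ) (K : ℝ), (∀ᶠ u in atTop, |(n u : ℝ) - t u| ≤ 1) →
      Tendsto n atTop atTop ∧
      Tendsto (fun u ↦ (√(n u))⁻¹ * ((u - K) - n u * m)) atTop (𝓝 (-(x * (m * √m)))) := by
    intro n K hn
    have hn' : Tendsto (fun u ↦ (n u : ℝ)) atTop atTop := by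
      refine tendsto_atTop_mono' _ ?_ (tendsto_atTop_add_const_right _ (-1) htop)
      filter_upwards [hn] with u hu
      linarith [(abs_le.1 hu).1]
    refine ⟨tendsto_natCast_atTop_iff.1 hn', ?_⟩
    have h1 : Tendsto (fun u ↦ ((n u : ℝ) - t u) / u) atTop (𝓝 0) := by
      refine squeeze_zero_norm' ?_ tendsto_inv_atTop_zero
      filter_upwards [hn, eventually_gt_atTop 0] with u hu hu0
      rw [norm_div, Real.norm_eq_abs, Real.norm_eq_abs, abs_of_pos hu0, inv_eq_one_div]
      gcongr
    have h2 : Tendsto (fun u ↦ (√(n u / u))⁻¹) atTop (𝓝 (√m)) := by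
      have h3 := h1.add htu
      have h4 : Tendsto (fun u ↦ (n u : ℝ) / u) atTop (𝓝 (1 / m)) := by
        rw [zero_add] at h3
        refine h3.congr fun u ↦ ?_
        ring
      have h5 := (h4.sqrt).inv₀ (by positivity)
      simpa using h5
    have h3 : Tendsto (fun u ↦ (√u)⁻¹ * ((u - K) - n u * m)) atTop (𝓝 (-(x * m))) := by
      have h4 : Tendsto (fun u ↦ (√u)⁻¹ * (-K - (n u - t u) * m)) atTop (𝓝 0) := by
        refine squeeze_zero_norm' (a := fun u ↦ (√u)⁻¹ * (|K| + m)) ?_ ?_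
        · filter_upwards [hn] with u hu
          rw [norm_mul, Real.norm_eq_abs, abs_of_nonneg (by positivity : 0 ≤ (√u)⁻¹)]
          gcongr
          calc ‖-K - (n u - t u) * m‖ ≤ ‖-K‖ + ‖(n u - t u) * m‖ := norm_sub_le _ _
            _ ≤ |K| + 1 * m := by
              rw [norm_neg, norm_mul, Real.norm_eq_abs, Real.norm_eq_abs, Real.norm_eq_abs,
                abs_of_pos hm]
              gcongr
            _ = |K| + m := by rw [one_mul]
        · simpa using hsqrt.mul_const (|K| + m)
      have h5 := h4.add_const (-(x * m))
      rw [zero_add] at h5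
      refine h5.congr' ?_
      filter_upwards [eventually_gt_atTop 0] with u hu
      have h3 : 0 < √u := Real.sqrt_pos.2 hu
      simp only [ht]
      field_simp
      ring
    have h6 := h2.mul h3
    rw [show √m * -(x * m) = -(x * (m * √m)) by ring] at h6
    refine h6.congr' ?_
    filter_upwards [eventually_gt_atTop 0] with u hu
    have h3 : 0 < √u := Real.sqrt_pos.2 hu
    rw [Real.sqrt_div' _ hu.le, inv_div, ← mul_assoc]
    congr 1
    field_simp
  have hfloor : ∀ᶠ u in atTop, (⌊t u⌋₊ : ℝ) ≤ t u := by
    filter_upwards [htop.eventually_ge_atTop 0] with u hu using Nat.floor_le hu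
  have hlt : ∀ u, t u < ⌊t u⌋₊ + 1 := fun u ↦ Nat.lt_floor_add_one _
  have hlow : Tendsto (fun u ↦ P.real {ω | u < S ⌊t u⌋₊ ω}) atTop
      (𝓝 (ν.real (Set.Ioi (-(x * (m * √m)))))) := by
    obtain ⟨h1, h2⟩ := hkey (fun u ↦ ⌊t u⌋₊) 0 (by
      filter_upwards [hfloor] with u hu
      rw [abs_le]
      constructor <;> linarith [hlt u])
    exact tendsto_measureReal_lt_of_tendstoInDistribution hclt h1 (by simpa using h2) hx
  rw [tendsto_order]
  refine ⟨fun a ha ↦ ?_, fun a ha ↦ ?_⟩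
  · filter_upwards [(tendsto_order.1 hlow).1 a ha, hfloor] with u hu hu'
    exact hu.trans_le (h.measureReal_lt_le _ hu')
  · obtain ⟨ε, hε, haε⟩ : ∃ ε > 0, ν.real (Set.Ioi (-(x * (m * √m)))) + ε = a :=
      ⟨_, sub_pos.2 ha, by ring⟩
    obtain ⟨K, hK⟩ := h.measureReal_toReal_le hfin (half_pos hε)
    obtain ⟨h1, h2⟩ := hkey (fun u ↦ ⌊t u⌋₊ + 1) K (by
      filter_upwards [hfloor] with u hu
      push_cast
      rw [abs_le]
      constructor <;> linarith [hlt u])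
    have h3 := tendsto_measureReal_lt_of_tendstoInDistribution hclt h1 h2 hx
    filter_upwards [(tendsto_order.1 h3).2 (a - ε / 2) (by linarith)] with u hu
    have := hK (⌊t u⌋₊ + 1) u (t u) (by push_cast; exact hlt u)
    linarith

theorem tendstoInDistribution (h : IsApproxPassageTime S τ P) (hm : 0 < m)
    (hτ : ∀ u, AEMeasurable (τ u) P)
    (hfin : ∀ᵐ ω ∂P, ∀ u, τ u ω < ∞) {V : ℝ}
    (hclt : TendstoInDistribution (fun (n : ℕ) ω ↦ (√n)⁻¹ * (S n ω - n * m)) atTop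
      (id : ℝ → ℝ) (fun _ ↦ P) (gaussianReal 0 V.toNNReal)) :
    TendstoInDistribution (fun (u : ℝ) ω ↦ ((τ u ω).toReal - u / m) / √u) atTop
      (id : ℝ → ℝ) (fun _ ↦ P) (gaussianReal 0 (V / m ^ 3).toNNReal) := by
  have hmeas : ∀ u : ℝ, AEMeasurable (fun ω ↦ ((τ u ω).toReal - u / m) / √u) P :=
    fun u ↦ ((hτ u).ennreal_toReal.sub_const _).div_const _
  refine ⟨hmeas, aemeasurable_id, ?_⟩
  -- The point `0` is left out because it is an atom of the limit when the variance vanishes.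
  refine tendsto_probabilityMeasure_of_tendsto_Iic (D := {0}ᶜ) (dense_compl_singleton 0) ?_
  intro x hx
  have hms : 0 < m * √m := by positivity
  have hnull : ∀ y : ℝ, y ≠ 0 → gaussianReal 0 V.toNNReal {y} = 0 := by
    intro y hy
    by_cases hV : V.toNNReal = 0
    · rw [hV, gaussianReal_zero_var]
      simp [hy.symm]
    · have := nullSingletonClass_gaussianReal (μ := 0) hV
      exact measure_singleton y
  have hc : -(x * (m * √m)) ≠ 0 := neg_ne_zero.2 (mul_ne_zero hx hms.ne')
  have h1 := h.tendsto_measureReal_le hm hfin hclt (hnull _ hc)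
  have hlim : (gaussianReal 0 (V / m ^ 3).toNNReal).real (Set.Iic x) =
      (gaussianReal 0 V.toNNReal).real (Set.Ioi (-(x * (m * √m)))) := by
    -- The negative factor turns an upper half-line into a lower one, and its square is `1 / m ^ 3`;
    -- a centred Gaussian stays centred.
    have hmap : (gaussianReal 0 V.toNNReal).map (fun y ↦ -(m * √m)⁻¹ * y) =
        gaussianReal 0 (V / m ^ 3).toNNReal := by
      rw [gaussianReal_map_const_mul, mul_zero]
      congr 1
      ext
      have h2 : (m * √m) ^ 2 = m ^ 3 := by
        rw [mul_pow, Real.sq_sqrt hm.le]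
        ring
      rw [NNReal.coe_mul, NNReal.coe_mk, neg_sq, inv_pow, h2, Real.coe_toNNReal', Real.coe_toNNReal',
        ← div_eq_inv_mul, max_div_div_right (by positivity : 0 ≤ m ^ 3) V 0 |>.symm, zero_div]
    rw [← hmap, measureReal_def, measureReal_def, Measure.map_apply (by fun_prop) measurableSet_Iic]
    have h2 : (fun y ↦ -(m * √m)⁻¹ * y) ⁻¹' Set.Iic x = Set.Ici (-(x * (m * √m))) := by
      ext y
      simp only [Set.mem_preimage, Set.mem_Iic, Set.mem_Ici]
      rw [neg_mul, ← div_eq_inv_mul, neg_le, le_div_iff₀ hms, neg_mul]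
    rw [h2]
    congr 1
    refine le_antisymm ?_ (measure_mono Set.Ioi_subset_Ici_self)
    rw [← Set.Ioi_union_left]
    refine (measure_union_le _ _).trans ?_
    rw [hnull _ hc, add_zero]
  simp only [ProbabilityMeasure.coe_mk, Measure.map_id]
  rw [hlim]
  refine h1.congr' ?_
  filter_upwards [eventually_gt_atTop 0] with u hu
  rw [measureReal_def, measureReal_def,
    Measure.map_apply_of_aemeasurable (hmeas u) measurableSet_Iic]
  congr 2
  ext ω
  simp only [Set.mem_preimage, Set.mem_Iic, Set.mem_ofPred_eq]
  rw [div_le_iff₀ (Real.sqrt_pos.2 hu), sub_le_iff_le_add, add_comm]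

end IsApproxPassageTime
end Passage

/-! ### Càdlàg paths and approximation along dense sets of times -/

namespace IsCadlagPath

variable {f g : ℝ≥0 → ℝ}

theorem sub (hf : IsCadlagPath f) (hg : IsCadlagPath g) : IsCadlagPath (fun t ↦ f t - g t) := by
  intro t
  obtain ⟨a, ha⟩ := (hf t).2
  obtain ⟨b, hb⟩ := (hg t).2
  exact ⟨(hf t).1.sub (hg t).1, a - b, ha.sub hb⟩

/-- Near each time the left limit and right continuity bound the path on either side; compactness of
`[0, t]` patches the local bounds. -/
theorem exists_abs_le (hf : IsCadlagPath f) (t : ℝ≥0) : ∃ C, ∀ s ≤ t, |f s| ≤ C := by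
  have key : ∃ C, ∀ s ∈ Set.Icc 0 t, |f s| ≤ C := by
    refine isCompact_Icc.induction_on (p := fun A ↦ ∃ C, ∀ s ∈ A, |f s| ≤ C) ⟨0, by simp⟩
      (fun A B hAB ⟨C, hC⟩ ↦ ⟨C, fun s hs ↦ hC s (hAB hs)⟩) ?_ ?_
    · rintro A B ⟨C, hC⟩ ⟨C', hC'⟩
      refine ⟨max C C', fun s hs ↦ ?_⟩
      rcases hs with hs | hs
      · exact (hC s hs).trans (le_max_left _ _)
      · exact (hC' s hs).trans (le_max_right _ _)
    · intro x _
      obtain ⟨l, hl⟩ := (hf x).2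
      have h1 : ∀ᶠ s in 𝓝[<] x, |f s| < |l| + 1 := hl.abs.eventually_lt_const (by linarith)
      have h2 : ∀ᶠ s in 𝓝[≥] x, |f s| < |f x| + 1 :=
        (continuousWithinAt_Ioi_iff_Ici.1 (hf x).1).abs.eventually_lt_const (by linarith)
      have h3 : ∀ᶠ s in 𝓝 x, |f s| < max (|l| + 1) (|f x| + 1) := by
        rw [← nhdsLT_sup_nhdsGE, eventually_sup]
        exact ⟨h1.mono fun s hs ↦ hs.trans_le (le_max_left _ _),
          h2.mono fun s hs ↦ hs.trans_le (le_max_right _ _)⟩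
      exact ⟨_, mem_nhdsWithin_of_mem_nhds h3, _, fun s hs ↦ le_of_lt hs⟩
  obtain ⟨C, hC⟩ := key
  exact ⟨C, fun s hs ↦ hC s ⟨zero_le, hs⟩⟩

end IsCadlagPath

theorem ContinuousWithinAt.exists_mem_dense_lt {f : ℝ≥0 → ℝ} {t T : ℝ≥0} {D U : Set _}
    (hf : ContinuousWithinAt f (Set.Ioi t) t) (hD : Dense D) (htT : t < T) (hU : U ∈ 𝓝 (f t)) :
    ∃ s ∈ D, t < s ∧ s < T ∧ f s ∈ U := by
  obtain ⟨v, hv, hvU⟩ := (mem_nhdsGT_iff_exists_Ioo_subset' htT).1 (hf hU)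
  obtain ⟨s, hs, h1, h2⟩ := hD.exists_between (lt_min htT hv)
  exact ⟨s, hs, h1, h2.trans_le (min_le_left _ _), hvU ⟨h1, h2.trans_le (min_le_right _ _)⟩⟩

theorem NNReal.dense_dyadic : Dense {x : ℝ≥0 | ∃ j k : ℕ, x = k * (2 ^ j)⁻¹} := by
  refine dense_of_exists_between fun a b hab ↦ ?_
  obtain ⟨j, hj⟩ := exists_pow_lt_of_lt_one (tsub_pos_of_lt hab) (by norm_num : (2 : ℝ≥0)⁻¹ < 1)
  have h2 : (0 : ℝ≥0) < 2 ^ j := by positivity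
  refine ⟨_, ⟨j, ⌊a * 2 ^ j⌋₊ + 1, rfl⟩, ?_, ?_⟩
  · rw [← div_eq_mul_inv, lt_div_iff₀ h2]
    exact_mod_cast Nat.lt_floor_add_one (a * 2 ^ j)
  · have h3 : ((⌊a * 2 ^ j⌋₊ + 1 : ℕ) : ℝ≥0) ≤ a * 2 ^ j + 1 := by
      push_cast
      gcongr
      exact Nat.floor_le zero_le
    calc ((⌊a * 2 ^ j⌋₊ + 1 : ℕ) : ℝ≥0) * (2 ^ j)⁻¹ ≤ (a * 2 ^ j + 1) * (2 ^ j)⁻¹ := by gcongr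
      _ = a + 2⁻¹ ^ j := by rw [add_mul, mul_assoc, mul_inv_cancel₀ h2.ne', mul_one, one_mul, inv_pow]
      _ < a + (b - a) := by gcongr
      _ = b := add_tsub_cancel_of_le hab.le

section RightContinuous

variable {Ω : Type*} [MeasurableSpace Ω] {P : Measure Ω}

/-- For a right-continuous process the probability of passing below a level up to an integer time
is at most the supremum of the corresponding probabilities along dyadic grids. -/
theorem measure_exists_lt_le_of_forall_dyadic {g : ℝ≥0 → Ω → ℝ}
    (hg : ∀ᵐ ω ∂P, ∀ t, ContinuousWithinAt (fun s ↦ g s ω) (Set.Ioi t) t) (n : ℕ) (c : ℝ)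
    {B : ℝ≥0∞}
    (hB : ∀ j : ℕ, P {ω | ∃ k ≤ n * 2 ^ j, g (k * (2 ^ j)⁻¹) ω < c} ≤ B) :
    P {ω | ∃ s ≤ (n : ℝ≥0), g s ω < c} ≤ B := by
  set E : ℕ → Set Ω := fun j ↦ {ω | ∃ k ≤ n * 2 ^ j, g (k * (2 ^ j)⁻¹) ω < c} with hE
  have hmono : Monotone E := by
    refine monotone_nat_of_le_succ fun j ω ↦ ?_
    rintro ⟨k, hk, hlt⟩
    refine ⟨k * 2, by rw [pow_succ, ← mul_assoc]; gcongr, ?_⟩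
    convert hlt using 2
    push_cast
    rw [pow_succ]
    field_simp
  have hsub : P {ω | ∃ s ≤ (n : ℝ≥0), g s ω < c} ≤ P (⋃ j, E j) := by
    refine measure_mono_ae ?_
    filter_upwards [hg] with ω hω
    rintro ⟨s, hs, hlt⟩
    refine Set.mem_iUnion.2 ?_
    rcases hs.lt_or_eq with hs | rfl
    · obtain ⟨_, ⟨j, k, rfl⟩, -, h2, h3⟩ :=
        (hω s).exists_mem_dense_lt NNReal.dense_dyadic hs (Iio_mem_nhds hlt)
      refine ⟨j, k, ?_, h3⟩
      rw [← div_eq_mul_inv, div_lt_iff₀ (by positivity)] at h2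
      exact_mod_cast h2.le
    -- The endpoint cannot be approximated from the right within the interval, but it lies on every
    -- grid.
    · exact ⟨0, n, by simp, by simpa using hlt⟩
  refine hsub.trans ?_
  rw [hmono.measure_iUnion]
  exact iSup_le hB

end RightContinuous

/-! ### Lévy processes: integer-time limit theorems and tight infima -/

namespace IsLevyProcess

variable {Ω : Type*} [MeasurableSpace Ω] {P : Measure Ω} {L : ℝ≥0 → Ω → ℝ}

theorem iIndepFun_grid (hL : IsLevyProcess L P) (h : ℝ≥0) :
    iIndepFun (fun (i : ℕ) ω ↦ L ((i + 1 : ℕ) * h) ω - L (i * h) ω) P :=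
  hL.indep_increments.nat (t := fun k ↦ k * h) (fun a b hab ↦ by dsimp only; gcongr)

theorem identDistrib_grid (hL : IsLevyProcess L P) (h : ℝ≥0) (i : ℕ) :
    IdentDistrib (fun ω ↦ L ((i + 1 : ℕ) * h) ω - L (i * h) ω) (L h) P P := by
  have := hL.stationary_increments (i * h) h
  rwa [show i * h + h = (i + 1 : ℕ) * h by push_cast; ring] at this

omit [MeasurableSpace Ω] in
theorem sum_grid (L : ℝ≥0 → Ω → ℝ) (h : ℝ≥0) (n : ℕ) (ω : Ω) :
    ∑ i ∈ Finset.range n, (L ((i + 1 : ℕ) * h) ω - L (i * h) ω) = L (n * h) ω - L 0 ω := by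
  rw [Finset.sum_range_sub (fun i : ℕ ↦ L (i * h) ω)]
  simp

theorem tendsto_div_ae (hL : IsLevyProcess L P) (hint : Integrable (L 1) P) :
    ∀ᵐ ω ∂P, Tendsto (fun n : ℕ ↦ L n ω / n) atTop (𝓝 (∫ ω, L 1 ω ∂P)) := by
  have hid := hL.identDistrib_grid 1
  have h1 := strong_law_ae_real _ ((hid 0).integrable_iff.2 hint)
    (fun i j hij ↦ (hL.iIndepFun_grid 1).indepFun hij) (fun i ↦ (hid i).trans (hid 0).symm)
  filter_upwards [h1, hL.zero] with ω hω h0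
  rw [(hid 0).integral_eq] at hω
  refine hω.congr fun n ↦ ?_
  rw [sum_grid, h0, sub_zero, mul_one]

theorem tendstoInDistribution [IsProbabilityMeasure P] (hL : IsLevyProcess L P)
    (hL2 : MemLp (L 1) 2 P) :
    TendstoInDistribution (fun (n : ℕ) ω ↦ (√n)⁻¹ * (L n ω - n * ∫ ω, L 1 ω ∂P)) atTop
      (id : ℝ → ℝ) (fun _ ↦ P) (gaussianReal 0 Var[L 1; P].toNNReal) := by
  have hid := hL.identDistrib_grid 1
  have h1 := tendstoInDistribution_inv_sqrt_mul_sum_sub (P := P)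
    (P' := gaussianReal 0 Var[L 1; P].toNNReal) (Y := id)
    (X := fun (i : ℕ) ω ↦ L ((i + 1 : ℕ) * 1) ω - L (i * 1) ω)
    ⟨aemeasurable_id, by rw [Measure.map_id, (hid 0).variance_eq]⟩
    ((hid 0).memLp_iff.2 hL2) (hL.iIndepFun_grid 1) (fun i ↦ (hid i).trans (hid 0).symm)
  refine h1.congr (fun n ↦ ?_) (ae_eq_refl _)
  filter_upwards [hL.zero] with ω h0
  rw [sum_grid, h0, sub_zero, mul_one, (hid 0).integral_eq]

/-- The past values and the later increment are sums over disjoint blocks of independent grid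
increments. -/
theorem indepFun_past_grid (hL : IsLevyProcess L P) (h : ℝ≥0) {k l : ℕ} (hkl : k ≤ l) :
    IndepFun (fun ω (j : Finset.range (k + 1)) ↦ L ((j : ℕ) * h) ω - L 0 ω)
      (fun ω ↦ L (l * h) ω - L (k * h) ω) P := by
  have h1 := (hL.iIndepFun_grid h).indepFun_finset (Finset.range k) (Finset.Ico k l)
    (Finset.disjoint_left.2 fun i hi hi' ↦ by simp at hi hi'; omega)
    (fun i ↦ (hL.measurable _).sub (hL.measurable _))
  have h2 := h1.comp
    (φ := fun x (j : Finset.range (k + 1)) ↦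
      ∑ i : Finset.range k, if (i : ℕ) < j then x i else 0)
    (ψ := fun x ↦ ∑ i, x i)
    (measurable_pi_lambda _ fun j ↦ Finset.measurable_sum _ fun i _ ↦ by
      split_ifs
      · exact measurable_pi_apply i
      · exact measurable_const)
    (Finset.measurable_sum _ fun i _ ↦ measurable_pi_apply i)
  convert h2 using 1
  · ext ω j
    have hj : (j : ℕ) ≤ k := Nat.lt_succ_iff.1 (Finset.mem_range.1 j.2)
    simp only [Function.comp_apply]
    rw [Finset.sum_coe_sort (Finset.range k)
      (fun i ↦ if i < (j : ℕ) then L ((i + 1 : ℕ) * h) ω - L (i * h) ω else 0),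
      ← Finset.sum_filter, ← sum_grid]
    congr 1
    ext i
    simp
    omega
  · ext ω
    simp only [Function.comp_apply]
    rw [Finset.sum_coe_sort (Finset.Ico k l)
      (fun i ↦ L ((i + 1 : ℕ) * h) ω - L (i * h) ω),
      Finset.sum_Ico_eq_sub _ hkl, sum_grid, sum_grid]
    ring

/-- Paths are bounded on `[0, 1]`, so one level dominates the whole segment with probability above
one half; this supplies the uniform constant of the Ottaviani argument. -/
theorem exists_half_le_measure (hL : IsLevyProcess L P) [IsProbabilityMeasure P] :
    ∃ a : ℝ, ∀ s ≤ 1, 2⁻¹ ≤ P {ω | L s ω ≤ a} := by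
  set G : ℕ → Set Ω := fun k ↦ {ω | ∀ s ≤ 1, |L s ω| ≤ k} with hG
  have hmono : Monotone G := fun i j hij ω hω s hs ↦ (hω s hs).trans (by exact_mod_cast hij)
  have h1 : P (⋃ k, G k) = 1 := by
    rw [← measure_univ (μ := P)]
    refine le_antisymm (measure_mono (Set.subset_univ _)) (measure_mono_ae ?_)
    filter_upwards [hL.cadlag] with ω hω
    obtain ⟨C, hC⟩ := hω.exists_abs_le 1
    obtain ⟨k, hk⟩ := exists_nat_ge C
    intro _
    exact Set.mem_iUnion.2 ⟨k, fun s hs ↦ (hC s hs).trans hk⟩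
  have h2 : (2⁻¹ : ℝ≥0∞) < ⨆ k, P (G k) := by
    rw [← hmono.measure_iUnion, h1]
    exact ENNReal.inv_lt_one.2 ENNReal.one_lt_two
  obtain ⟨k, hk⟩ := lt_iSup_iff.1 h2
  exact ⟨k, fun s hs ↦ hk.le.trans (measure_mono fun ω hω ↦ (le_abs_self _).trans (hω s hs))⟩

/-- An Ottaviani-type inequality: passage below a level along a fine grid is controlled by passage
below a level at integer times. -/
theorem measure_exists_grid_lt_le (hL : IsLevyProcess L P) {h : ℝ≥0} {q : ℕ}
    (hqh : q * h = 1) {a : ℝ} (ha : ∀ s ≤ 1, 2⁻¹ ≤ P {ω | L s ω ≤ a}) (K : ℝ) (N : ℕ) :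
    P {ω | ∃ k ≤ N, L (k * h) ω - L 0 ω < -(K + a)} ≤
      2 * P {ω | ∃ n : ℕ, L n ω - L 0 ω < -K} := by
  have hq : 0 < q := Nat.pos_of_ne_zero (by rintro rfl; simp at hqh)
  -- `A k` says that the first passage happens at index `k`: these events are disjoint and depend
  -- only on the past.
  set A : ℕ → Set Ω := fun k ↦ {ω | L (k * h) ω - L 0 ω < -(K + a) ∧
    ∀ j < k, -(K + a) ≤ L (j * h) ω - L 0 ω} with hA
  -- `l k * h` is the first integer time strictly after `k * h`, at most one unit away, so `ha`
  -- applies to the increment in `B k`.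
  set l : ℕ → ℕ := fun k ↦ (k / q + 1) * q with hl
  have hkl : ∀ k, k ≤ l k := fun k ↦ (Nat.lt_div_mul_add hq).le.trans (by simp [hl, add_mul])
  have hlk : ∀ k, l k - k ≤ q := fun k ↦ by
    have := Nat.div_mul_le_self k q
    simp only [hl, add_mul, one_mul]
    omega
  have hlh : ∀ k, (l k : ℝ≥0) * h = (k / q + 1 : ℕ) := fun k ↦ by
    simp only [hl]
    rw [Nat.cast_mul, mul_assoc, hqh, mul_one]
  set B : ℕ → Set Ω := fun k ↦ {ω | L (l k * h) ω - L (k * h) ω ≤ a} with hB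
  have hmeas : ∀ s : ℝ≥0, Measurable (fun ω ↦ L s ω - L 0 ω) :=
    fun s ↦ (hL.measurable s).sub (hL.measurable 0)
  have hAmeas : ∀ k, MeasurableSet (A k) := by
    intro k
    refine (measurableSet_lt (hmeas _) measurable_const).inter ?_
    have : {ω | ∀ j < k, -(K + a) ≤ L (j * h) ω - L 0 ω} =
        ⋂ j, ⋂ _ : j < k, {ω | -(K + a) ≤ L (j * h) ω - L 0 ω} := by
      ext; simp
    change MeasurableSet {ω | ∀ j < k, -(K + a) ≤ L (j * h) ω - L 0 ω}
    rw [this]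
    exact .iInter fun j ↦ .iInter fun _ ↦ measurableSet_le measurable_const (hmeas _)
  have hBmeas : ∀ k, MeasurableSet (B k) := fun k ↦
    measurableSet_le ((hL.measurable _).sub (hL.measurable _)) measurable_const
  have hPB : ∀ k, 2⁻¹ ≤ P (B k) := by
    intro k
    have h1 := hL.stationary_increments (k * h) ((l k - k : ℕ) * h)
    rw [← add_mul, ← Nat.cast_add, Nat.add_sub_cancel' (hkl k)] at h1
    have h2 := h1.measure_mem_eq (measurableSet_Iic (a := a))
    refine (ha ((l k - k : ℕ) * h) ?_).trans h2.symm.le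
    rw [← hqh]
    gcongr
    exact hlk k
  have hAB : ∀ k, P (A k) ≤ 2 * P (A k ∩ B k) := by
    intro k
    have hind := hL.indepFun_past_grid h (hkl k)
    have hAset : A k = (fun ω (j : Finset.range (k + 1)) ↦ L ((j : ℕ) * h) ω - L 0 ω) ⁻¹'
        {x | x ⟨k, by simp⟩ < -(K + a) ∧
          ∀ j : Finset.range (k + 1), (j : ℕ) < k → -(K + a) ≤ x j} := by
      ext ω
      simp only [hA, Set.mem_ofPred_eq, Set.mem_preimage]
      refine and_congr_right fun _ ↦ ⟨fun h j hj ↦ h j hj, fun h j hj ↦ ?_⟩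
      exact h ⟨j, Finset.mem_range.2 (by omega)⟩ hj
    have hset : MeasurableSet {x : Finset.range (k + 1) → ℝ | x ⟨k, by simp⟩ < -(K + a) ∧
          ∀ j : Finset.range (k + 1), (j : ℕ) < k → -(K + a) ≤ x j} := by
      refine (measurableSet_lt (measurable_pi_apply _) measurable_const).inter ?_
      change MeasurableSet {x : Finset.range (k + 1) → ℝ |
          ∀ j : Finset.range (k + 1), (j : ℕ) < k → -(K + a) ≤ x j}
      simp only [Set.ofPred_forall]
      exact .iInter fun j ↦ .iInter fun _ ↦ measurableSet_le measurable_const (measurable_pi_apply j)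
    have hmul : P (A k ∩ B k) = P (A k) * P (B k) := by
      rw [hAset]
      exact hind.measure_inter_preimage_eq_mul _ _ hset measurableSet_Iic
    rw [hmul]
    calc P (A k) = 2 * (P (A k) * 2⁻¹) := by
          rw [mul_comm (P (A k)), ← mul_assoc,
            ENNReal.mul_inv_cancel two_ne_zero ENNReal.ofNat_ne_top, one_mul]
      _ ≤ 2 * (P (A k) * P (B k)) := by gcongr; exact hPB k
  have hdisj : (Finset.range (N + 1) : Set ℕ).PairwiseDisjoint (fun k ↦ A k ∩ B k) := by
    intro i _ j _ hij
    refine Set.disjoint_left.2 fun ω h1 h2 ↦ ?_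
    rcases lt_or_gt_of_ne hij with hlt | hlt
    · exact absurd h1.1.1 (not_lt.2 (h2.1.2 i hlt))
    · exact absurd h2.1.1 (not_lt.2 (h1.1.2 j hlt))
  calc P {ω | ∃ k ≤ N, L (k * h) ω - L 0 ω < -(K + a)}
      ≤ P (⋃ k ∈ Finset.range (N + 1), A k) := by
        refine measure_mono ?_
        rintro ω ⟨k, hk, hlt⟩
        classical
        have hex : ∃ k : ℕ, L (k * h) ω - L 0 ω < -(K + a) := ⟨k, hlt⟩
        have hle := Nat.find_min' hex hlt
        refine Set.mem_biUnion (x := Nat.find hex) (Finset.mem_coe.2 (Finset.mem_range.2 (Nat.lt_succ_of_le (hle.trans hk))))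
          ⟨Nat.find_spec hex, fun j hj ↦ not_lt.1 (Nat.find_min hex hj)⟩
    _ ≤ ∑ k ∈ Finset.range (N + 1), P (A k) := measure_biUnion_finset_le _ _
    _ ≤ ∑ k ∈ Finset.range (N + 1), 2 * P (A k ∩ B k) := Finset.sum_le_sum fun k _ ↦ hAB k
    _ = 2 * P (⋃ k ∈ Finset.range (N + 1), A k ∩ B k) := by
        rw [← Finset.mul_sum,
          measure_biUnion_finset hdisj fun k _ ↦ (hAmeas k).inter (hBmeas k)]
    _ ≤ 2 * P {ω | ∃ n : ℕ, L n ω - L 0 ω < -K} := by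
        gcongr
        -- From below `-(K + a)` at time `k * h`, a rise of at most `a` leaves the path below `-K`
        -- at the next integer.
        refine Set.iUnion₂_subset fun k _ ω hω ↦ ⟨k / q + 1, ?_⟩
        have h1 : L (l k * h) ω - L (k * h) ω ≤ a := hω.2
        have h2 := hω.1.1
        rw [hlh] at h1
        linarith

/-- Reversal of time does not change the law of the increments along a grid. -/
theorem measure_exists_grid_reverse (hL : IsLevyProcess L P) [IsProbabilityMeasure P] (h : ℝ≥0)
    (N : ℕ) (c : ℝ) :
    P {ω | ∃ k ≤ N, L (N * h) ω - L (k * h) ω < c} =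
      P {ω | ∃ k ≤ N, L (k * h) ω - L 0 ω < c} := by
  set ξ : ℕ → Ω → ℝ := fun i ω ↦ L ((i + 1 : ℕ) * h) ω - L (i * h) ω with hξ
  have hmeas : ∀ i, Measurable (ξ i) := fun i ↦ (hL.measurable _).sub (hL.measurable _)
  have hind := hL.iIndepFun_grid h
  have h1 : iIndepFun (fun (i : Fin N) ↦ ξ i) P := hind.precomp Fin.val_injective
  have h2 : iIndepFun (fun (i : Fin N) ↦ ξ i.rev) P :=
    hind.precomp (g := fun i : Fin N ↦ (i.rev : ℕ)) (Fin.val_injective.comp Fin.rev_injective)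
  have hlaw : P.map (fun ω (i : Fin N) ↦ ξ i ω) = P.map (fun ω (i : Fin N) ↦ ξ i.rev ω) := by
    rw [(iIndepFun_iff_map_fun_eq_pi_map fun i ↦ (hmeas _).aemeasurable).1 h1,
      (iIndepFun_iff_map_fun_eq_pi_map fun i ↦ (hmeas _).aemeasurable).1 h2]
    congr 1
    ext1 i
    exact ((hL.identDistrib_grid h _).trans (hL.identDistrib_grid h _).symm).map_eq
  set T : Set (Fin N → ℝ) := {x | ∃ k ≤ N, ∑ i : Fin N, (if (i : ℕ) < k then x i else 0) < c} with hT
  have hTmeas : MeasurableSet T := by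
    have : T = ⋃ k, ⋃ _ : k ≤ N, {x | ∑ i : Fin N, (if (i : ℕ) < k then x i else 0) < c} := by
      ext; simp [hT]
    rw [this]
    refine .iUnion fun k ↦ .iUnion fun _ ↦ measurableSet_lt ?_ measurable_const
    refine Finset.measurable_sum _ fun i _ ↦ ?_
    split_ifs
    · exact measurable_pi_apply i
    · exact measurable_const
  have hsum : ∀ ω, ∀ k ≤ N, ∑ i : Fin N, (if (i : ℕ) < k then ξ i ω else 0) =
      L (k * h) ω - L 0 ω := by
    intro ω k hk
    rw [Fin.sum_univ_eq_sum_range (fun i ↦ if i < k then ξ i ω else 0), ← Finset.sum_filter,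
      ← sum_grid]
    congr 1
    ext i
    simp
    omega
  have hfwd : {ω | ∃ k ≤ N, L (k * h) ω - L 0 ω < c} = (fun ω (i : Fin N) ↦ ξ i ω) ⁻¹' T := by
    ext ω
    simp only [Set.mem_ofPred_eq, Set.mem_preimage, hT]
    exact exists_congr fun k ↦ and_congr_right fun hk ↦ by rw [hsum ω k hk]
  -- The first `k` reversed increments are the last `k` original ones.
  have hsum' : ∀ ω, ∀ k ≤ N, ∑ i : Fin N, (if (i : ℕ) < k then ξ i.rev ω else 0) =
      L (N * h) ω - L ((N - k : ℕ) * h) ω := by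
    intro ω k hk
    rw [← Equiv.sum_comp Fin.revPerm]
    have h3 : ∀ i : Fin N, (if ((Fin.revPerm i : Fin N) : ℕ) < k then
        ξ ((Fin.revPerm i : Fin N).rev) ω else 0) =
        ξ i ω - (if (i : ℕ) < N - k then ξ i ω else 0) := by
      intro i
      have : (N - (i + 1) < k) ↔ ¬ ((i : ℕ) < N - k) := by omega
      simp only [Fin.revPerm_apply, Fin.rev_rev, Fin.val_rev]
      split_ifs <;> simp <;> omega
    simp only [h3]
    rw [Finset.sum_sub_distrib, hsum ω _ (Nat.sub_le _ _),
      Fin.sum_univ_eq_sum_range (fun i ↦ ξ i ω), sum_grid]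
    ring
  have hrev : {ω | ∃ k ≤ N, L (N * h) ω - L (k * h) ω < c} =
      (fun ω (i : Fin N) ↦ ξ i.rev ω) ⁻¹' T := by
    ext ω
    simp only [Set.mem_ofPred_eq, Set.mem_preimage, hT]
    constructor
    · rintro ⟨k, hk, hlt⟩
      refine ⟨N - k, Nat.sub_le _ _, ?_⟩
      rw [hsum' ω _ (Nat.sub_le _ _), Nat.sub_sub_self hk]
      exact hlt
    · rintro ⟨k, hk, hlt⟩
      rw [hsum' ω k hk] at hlt
      exact ⟨N - k, Nat.sub_le _ _, hlt⟩
  rw [hfwd, hrev, ← Measure.map_apply (measurable_pi_lambda _ fun i ↦ hmeas _) hTmeas,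
    ← Measure.map_apply (measurable_pi_lambda _ fun i ↦ hmeas _) hTmeas, hlaw]

/-- By the strong law the path at integer times tends to `+∞`, hence is bounded below; the events
decrease to a null set. -/
theorem tendsto_measure_exists_nat_lt (hL : IsLevyProcess L P) [IsProbabilityMeasure P]
    (hint : Integrable (L 1) P) (hpos : 0 < ∫ ω, L 1 ω ∂P) :
    Tendsto (fun K : ℕ ↦ P {ω | ∃ n : ℕ, L n ω - L 0 ω < -K}) atTop (𝓝 0) := by
  have hmeas : ∀ K : ℕ, MeasurableSet {ω | ∃ n : ℕ, L n ω - L 0 ω < -K} := by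
    intro K
    simp only [Set.ofPred_exists]
    exact .iUnion fun n ↦ measurableSet_lt ((hL.measurable _).sub (hL.measurable _))
      measurable_const
  have hanti : Antitone fun K : ℕ ↦ {ω | ∃ n : ℕ, L n ω - L 0 ω < -K} := by
    rintro i j hij ω ⟨n, hn⟩
    exact ⟨n, hn.trans_le (neg_le_neg (by exact_mod_cast hij))⟩
  have h1 := tendsto_measure_iInter_atTop (fun K ↦ (hmeas K).nullMeasurableSet) hanti
    ⟨0, measure_ne_top P _⟩
  have h2 : P (⋂ K : ℕ, {ω | ∃ n : ℕ, L n ω - L 0 ω < -K}) = 0 := by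
    refine measure_eq_zero_iff_ae_notMem.2 ?_
    filter_upwards [hL.tendsto_div_ae hint] with ω hω hmem
    have h3 : Tendsto (fun n : ℕ ↦ L n ω / n * n) atTop atTop :=
      hω.pos_mul_atTop hpos tendsto_natCast_atTop_atTop
    have h4 : Tendsto (fun n : ℕ ↦ L n ω) atTop atTop := by
      refine h3.congr' ?_
      filter_upwards [eventually_gt_atTop 0] with n hn
      have : (n : ℝ) ≠ 0 := by exact_mod_cast hn.ne'
      field_simp
    obtain ⟨C, hC⟩ := bddBelow_range_of_tendsto_atTop_atTop h4
    obtain ⟨K, hK⟩ := exists_nat_ge (L 0 ω - C)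
    obtain ⟨n, hn⟩ := Set.mem_iInter.1 hmem K
    have := hC ⟨n, rfl⟩
    simp only at this
    linarith
  rwa [h2] at h1

/-- For a Lévy process with positive mean, the infimum of the path up to time `n`, and that of its
increments up to time `n`, are tight. -/
theorem exists_measureReal_exists_lt_le (hL : IsLevyProcess L P) [IsProbabilityMeasure P]
    (hint : Integrable (L 1) P) (hpos : 0 < ∫ ω, L 1 ω ∂P) {ε : ℝ} (hε : 0 < ε) :
    ∃ K : ℝ, ∀ n : ℕ, P.real {ω | ∃ s ≤ (n : ℝ≥0), L s ω < -K} ≤ ε ∧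
      P.real {ω | ∃ s ≤ (n : ℝ≥0), L n ω - L s ω < -K} ≤ ε := by
  obtain ⟨a, ha⟩ := hL.exists_half_le_measure
  have h1 := ENNReal.Tendsto.const_mul (a := 2) (hL.tendsto_measure_exists_nat_lt hint hpos)
    (Or.inr ENNReal.ofNat_ne_top)
  rw [mul_zero] at h1
  obtain ⟨K, hK⟩ := ((tendsto_order.1 h1).2 (ENNReal.ofReal ε) (by simpa)).exists
  have hgrid : ∀ N j : ℕ, P {ω | ∃ k ≤ N, L (k * (2 ^ j)⁻¹) ω - L 0 ω < -(K + a)} ≤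
      ENNReal.ofReal ε := fun N j ↦
    (hL.measure_exists_grid_lt_le (q := 2 ^ j) (by push_cast; field_simp) ha K N).trans hK.le
  refine ⟨K + a, fun n ↦ ⟨?_, ?_⟩⟩
  · refine ENNReal.toReal_le_of_le_ofReal hε.le ?_
    have h2 : P {ω | ∃ s ≤ (n : ℝ≥0), L s ω < -(K + a)} ≤
        P {ω | ∃ s ≤ (n : ℝ≥0), L s ω - L 0 ω < -(K + a)} := by
      refine measure_mono_ae ?_
      filter_upwards [hL.zero] with ω h0
      rintro ⟨s, hs, hlt⟩
      exact ⟨s, hs, by rwa [h0, sub_zero]⟩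
    refine h2.trans (measure_exists_lt_le_of_forall_dyadic
      (g := fun s ω ↦ L s ω - L 0 ω) ?_ n _ fun j ↦ hgrid _ j)
    filter_upwards [hL.cadlag] with ω hω t
    exact (hω t).1.sub continuousWithinAt_const
  · refine ENNReal.toReal_le_of_le_ofReal hε.le ?_
    refine measure_exists_lt_le_of_forall_dyadic
      (g := fun s ω ↦ L n ω - L s ω) ?_ n _ fun j ↦ ?_
    · filter_upwards [hL.cadlag] with ω hω t
      exact continuousWithinAt_const.sub (hω t).1
    · have h2 := hL.measure_exists_grid_reverse (2 ^ j)⁻¹ (n * 2 ^ j) (-(K + a))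
      have h3 : ((n * 2 ^ j : ℕ) : ℝ≥0) * (2 ^ j)⁻¹ = n := by push_cast; field_simp
      rw [h3] at h2
      exact h2.le.trans (hgrid _ j)

end IsLevyProcess

/-! ### Difference of independent Lévy processes -/

section Sub

variable {Ω : Type*} [MeasurableSpace Ω] {P : Measure Ω} [IsProbabilityMeasure P]

/-- The joint characteristic function factors first between the two families and then over the
indices; regrouping gives the product of those of the differences. -/
theorem iIndepFun.sub_of_indepFun {ι : Type*} [Fintype ι] {f g : ι → Ω → ℝ}
    (hf : iIndepFun f P) (hg : iIndepFun g P) (hfm : ∀ i, Measurable (f i))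
    (hgm : ∀ i, Measurable (g i))
    (hfg : IndepFun (fun ω i ↦ f i ω) (fun ω i ↦ g i ω) P) :
    iIndepFun (fun i ω ↦ f i ω - g i ω) P := by
  have hgm' : ∀ i, Measurable (fun ω ↦ -g i ω) := fun i ↦ (hgm i).neg
  have hg' : iIndepFun (fun i ω ↦ -g i ω) P := hg.comp (fun _ x ↦ -x) (fun _ ↦ measurable_neg)
  have hfg' : IndepFun (fun ω i ↦ f i ω) (fun ω i ↦ -g i ω) P :=
    hfg.comp (φ := fun x ↦ x) (ψ := fun (x : ι → ℝ) (i : ι) ↦ -x i) measurable_id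
      (by fun_prop)
  have hsm : ∀ i, AEMeasurable (fun ω ↦ f i ω - g i ω) P :=
    fun i ↦ ((hfm i).sub (hgm i)).aemeasurable
  rw [iIndepFun_iff_charFun_pi hsm]
  intro t
  have h1 := (iIndepFun_iff_charFun_pi fun i ↦ (hfm i).aemeasurable).1 hf t
  have h2 := (iIndepFun_iff_charFun_pi fun i ↦ (hgm' i).aemeasurable).1 hg' t
  have hF : Measurable fun ω ↦ WithLp.toLp 2 (fun i ↦ f i ω) :=
    (WithLp.measurable_toLp 2 _).comp (measurable_pi_lambda _ hfm)
  have hG : Measurable fun ω ↦ WithLp.toLp 2 (fun i ↦ -g i ω) :=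
    (WithLp.measurable_toLp 2 _).comp (measurable_pi_lambda _ hgm')
  have hFG : IndepFun (fun ω ↦ WithLp.toLp 2 (fun i ↦ f i ω))
      (fun ω ↦ WithLp.toLp 2 (fun i ↦ -g i ω)) P :=
    hfg'.comp (WithLp.measurable_toLp 2 _) (WithLp.measurable_toLp 2 _)
  have h3 := hFG.charFun_map_add_eq_mul hF.aemeasurable hG.aemeasurable
  have h4 : (fun ω ↦ WithLp.toLp 2 (fun i ↦ f i ω)) + (fun ω ↦ WithLp.toLp 2 (fun i ↦ -g i ω)) =
      fun ω ↦ WithLp.toLp 2 (fun i ↦ f i ω - g i ω) := by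
    ext ω i
    simp [sub_eq_add_neg]
  rw [← h4, h3, Pi.mul_apply, h1, h2, ← Finset.prod_mul_distrib]
  refine Finset.prod_congr rfl fun i _ ↦ ?_
  have h5 : IndepFun (f i) (fun ω ↦ -g i ω) P :=
    hfg'.comp (measurable_pi_apply i) (measurable_pi_apply i)
  have h6 := h5.charFun_map_add_eq_mul (hfm i).aemeasurable (hgm' i).aemeasurable
  have h7 : f i + (fun ω ↦ -g i ω) = fun ω ↦ f i ω - g i ω := by
    ext ω
    simp [sub_eq_add_neg]
  rw [← Pi.mul_apply, ← h6, h7]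

theorem IsLevyProcess.sub {X Y : ℝ≥0 → Ω → ℝ} (hX : IsLevyProcess X P) (hY : IsLevyProcess Y P)
    (hXY : IndepFun (fun ω t ↦ X t ω) (fun ω t ↦ Y t ω) P) :
    IsLevyProcess (fun t ω ↦ X t ω - Y t ω) P where
  measurable t := (hX.measurable t).sub (hY.measurable t)
  zero := by
    filter_upwards [hX.zero, hY.zero] with ω h1 h2
    rw [h1, h2, sub_zero]
  indep_increments := by
    intro n t ht
    have hψ : Measurable fun (x : ℝ≥0 → ℝ) (i : Fin n) ↦ x (t i.succ) - x (t i.castSucc) := by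
      fun_prop
    convert iIndepFun.sub_of_indepFun (hX.indep_increments n t ht) (hY.indep_increments n t ht)
      (fun i ↦ (hX.measurable _).sub (hX.measurable _))
      (fun i ↦ (hY.measurable _).sub (hY.measurable _)) (hXY.comp hψ hψ) using 3
    ring
  stationary_increments s t := by
    have h1 := (hX.stationary_increments s t).prodMk (hY.stationary_increments s t)
      (hXY.comp (φ := fun x : ℝ≥0 → ℝ ↦ x (s + t) - x s)
        (ψ := fun x : ℝ≥0 → ℝ ↦ x (s + t) - x s)
        (by fun_prop) (by fun_prop))
      (hXY.comp (φ := fun x : ℝ≥0 → ℝ ↦ x t) (ψ := fun x : ℝ≥0 → ℝ ↦ x t) (by fun_prop)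
        (by fun_prop))
    convert h1.comp (u := fun p : ℝ × ℝ ↦ p.1 - p.2) (by fun_prop) using 1
    · ext ω
      simp only [Function.comp_apply]
      ring
    · rfl
  cadlag := by
    filter_upwards [hX.cadlag, hY.cadlag] with ω h1 h2 using h1.sub h2

end Sub

/-! ### The reflected process and its passage times -/

section Reflected

variable {Ω : Type*} [MeasurableSpace Ω] {P : Measure Ω} {X Y : ℝ≥0 → Ω → ℝ}

omit [MeasurableSpace Ω] in
theorem lt_reflectedProcess_iff {ω : Ω} (hX : IsCadlagPath fun t ↦ X t ω)
    (hY : IsCadlagPath fun t ↦ Y t ω) {u : ℝ} {s : ℝ≥0} :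
    u < reflectedProcess X Y s ω ↔ ∃ r ≤ s, u < X s ω - (X r ω - Y r ω) := by
  obtain ⟨C, hC⟩ := (hX.sub hY).exists_abs_le s
  have hbdd : BddBelow (Set.range fun r : Set.Iic s ↦ X r ω - Y r ω) :=
    ⟨-C, by rintro _ ⟨r, rfl⟩; exact (abs_le.1 (hC r r.2)).1⟩
  have : Nonempty (Set.Iic s) := ⟨⟨s, Set.self_mem_Iic⟩⟩
  rw [reflectedProcess, lt_sub_comm, ciInf_lt_iff hbdd]
  constructor
  · rintro ⟨r, hr⟩
    exact ⟨r, r.2, lt_sub_comm.1 hr⟩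
  · rintro ⟨r, hrs, hr⟩
    exact ⟨⟨r, hrs⟩, lt_sub_comm.1 hr⟩

omit [MeasurableSpace Ω] in
theorem firstPassageTime_lt_iff {V : ℝ≥0 → Ω → ℝ} {u : ℝ} {t : ℝ≥0} {ω : Ω} :
    firstPassageTime V u ω < t ↔ ∃ s < t, u < V s ω := by
  refine (hittingAfter_lt_iff (u := V) (s := Set.Ioi u) (n := 0) (i := t) (ω := ω)).trans ?_
  simp

omit [MeasurableSpace Ω] in
theorem firstPassageTime_le {V : ℝ≥0 → Ω → ℝ} {u : ℝ} {t : ℝ≥0} {ω : Ω} (h : u < V t ω) :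
    firstPassageTime V u ω ≤ t :=
  hittingAfter_le_of_mem (u := V) (s := Set.Ioi u) (n := 0) zero_le h

/-- On càdlàg paths the passage time is an infimum over pairs `r ≤ s` from a countable dense set,
because strict inequalities survive small moves to the right. -/
theorem aemeasurable_firstPassageTime_reflectedProcess (hX : ∀ t, Measurable (X t))
    (hY : ∀ t, Measurable (Y t)) (hXc : ∀ᵐ ω ∂P, IsCadlagPath fun t ↦ X t ω)
    (hYc : ∀ᵐ ω ∂P, IsCadlagPath fun t ↦ Y t ω) (u : ℝ) :
    AEMeasurable (firstPassageTime (reflectedProcess X Y) u) P := by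
  classical
  obtain ⟨D, hDc, hD⟩ := TopologicalSpace.exists_countable_dense ℝ≥0
  have := hDc.to_subtype
  have hms : ∀ p : {p : D × D // p.1 ≤ p.2},
      MeasurableSet {ω | u < X p.1.2 ω - (X p.1.1 ω - Y p.1.1 ω)} := fun p ↦
    measurableSet_lt measurable_const ((hX _).sub ((hX _).sub (hY _)))
  refine ⟨fun ω ↦ ⨅ p : {p : D × D // p.1 ≤ p.2},
    if u < X p.1.2 ω - (X p.1.1 ω - Y p.1.1 ω) then ((p.1.2 : ℝ≥0) : ℝ≥0∞) else ∞,
    .iInf fun p ↦ .ite (hms p) measurable_const measurable_const, ?_⟩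
  filter_upwards [hXc, hYc] with ω hXω hYω
  refine le_antisymm (le_iInf fun p ↦ ?_) (le_of_forall_gt fun c hc ↦ ?_)
  · split_ifs with hlt
    · exact firstPassageTime_le ((lt_reflectedProcess_iff hXω hYω).2 ⟨p.1.1, p.2, hlt⟩)
    · exact le_top
  · obtain ⟨t, ht, htc⟩ := ENNReal.lt_iff_exists_nnreal_btwn.1 hc
    obtain ⟨s, hst, hus⟩ := firstPassageTime_lt_iff.1 ht
    obtain ⟨r, hrs, hur⟩ := (lt_reflectedProcess_iff hXω hYω).1 hus
    -- The time `s` is moved first: this opens a gap after `r ≤ s < s'` in which `r'` can be chosen.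
    obtain ⟨s', hs', hss', hs't, hus'⟩ := (hXω s).1.exists_mem_dense_lt hD hst
      (Ioi_mem_nhds (show u + (X r ω - Y r ω) < X s ω by linarith))
    obtain ⟨r', hr', -, hr's', hur'⟩ := ((hXω.sub hYω) r).1.exists_mem_dense_lt hD
      (hrs.trans_lt hss') (Iio_mem_nhds (show X r ω - Y r ω < X s' ω - u by
        linarith [Set.mem_Ioi.1 hus']))
    refine (iInf_le _ ⟨(⟨r', hr'⟩, ⟨s', hs'⟩), hr's'.le⟩).trans_lt ?_
    rw [if_pos (lt_sub_comm.1 (Set.mem_Iio.1 hur'))]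
    exact lt_trans (by exact_mod_cast hs't) htc

variable [IsProbabilityMeasure P]

theorem isApproxPassageTime_of_integral_sub_pos (hX : IsLevyProcess X P) (hY : IsLevyProcess Y P)
    (hXY : IndepFun (fun ω t ↦ X t ω) (fun ω t ↦ Y t ω) P)
    (hX1 : Integrable (X 1) P) (hY1 : Integrable (Y 1) P)
    (hX_pos : 0 < ∫ ω, X 1 ω ∂P) (hZ_pos : 0 < ∫ ω, (X 1 ω - Y 1 ω) ∂P) :
    IsApproxPassageTime (fun n : ℕ ↦ X n) (firstPassageTime (reflectedProcess X Y)) P where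
  le_of_lt := by
    filter_upwards [hX.zero, hY.zero, hX.cadlag, hY.cadlag] with ω hX0 hY0 hXω hYω u n hun
    exact firstPassageTime_le (t := n)
      ((lt_reflectedProcess_iff hXω hYω).2 ⟨0, zero_le, by simpa [hX0, hY0] using hun⟩)
  tight ε hε := by
    obtain ⟨K₁, hK₁⟩ := (hX.sub hY hXY).exists_measureReal_exists_lt_le (hX1.sub hY1) hZ_pos
      (half_pos hε)
    obtain ⟨K₂, hK₂⟩ := hX.exists_measureReal_exists_lt_le hX1 hX_pos (half_pos hε)
    refine ⟨K₁ + K₂, fun n u ↦ ?_⟩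
    have hsub : P.real {ω | firstPassageTime (reflectedProcess X Y) u ω < n ∧
        X n ω ≤ u - (K₁ + K₂)} ≤
        P.real ({ω | ∃ s ≤ (n : ℝ≥0), X s ω - Y s ω < -K₁} ∪
          {ω | ∃ s ≤ (n : ℝ≥0), X n ω - X s ω < -K₂}) := by
      refine ENNReal.toReal_mono (measure_ne_top _ _) (measure_mono_ae ?_)
      filter_upwards [hX.cadlag, hY.cadlag] with ω hXω hYω
      rintro ⟨hτ, hle⟩
      obtain ⟨s, hsn, hus⟩ := firstPassageTime_lt_iff (t := n).1 hτ
      obtain ⟨r, hrs, hur⟩ := (lt_reflectedProcess_iff hXω hYω).1 hus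
      by_cases h : X r ω - Y r ω < -K₁
      · exact Or.inl ⟨r, hrs.trans hsn.le, h⟩
      -- Here `X s > u + Z r ≥ u - K₁`, so `X n ≤ u - (K₁ + K₂)` forces a drop of more than `K₂`
      -- after `s`.
      · exact Or.inr ⟨s, hsn.le, by linarith⟩
    refine (hsub.trans (measureReal_union_le _ _)).trans ?_
    linarith [(hK₁ n).1, (hK₂ n).2]

theorem isApproxPassageTime_of_integral_sub_neg (hX : IsLevyProcess X P) (hY : IsLevyProcess Y P)
    (hXY : IndepFun (fun ω t ↦ X t ω) (fun ω t ↦ Y t ω) P)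
    (hX1 : Integrable (X 1) P) (hY1 : Integrable (Y 1) P)
    (hX_pos : 0 < ∫ ω, X 1 ω ∂P) (hZ_pos : 0 < ∫ ω, (Y 1 ω - X 1 ω) ∂P) :
    IsApproxPassageTime (fun n : ℕ ↦ Y n) (firstPassageTime (reflectedProcess X Y)) P where
  le_of_lt := by
    filter_upwards [hX.cadlag, hY.cadlag] with ω hXω hYω u n hun
    exact firstPassageTime_le (t := n)
      ((lt_reflectedProcess_iff hXω hYω).2 ⟨n, le_rfl, by simpa using hun⟩)
  tight ε hε := by
    obtain ⟨K₁, hK₁⟩ := (hY.sub hX hXY.symm).exists_measureReal_exists_lt_le (hY1.sub hX1) hZ_pos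
      (half_pos hε)
    obtain ⟨K₂, hK₂⟩ := hX.exists_measureReal_exists_lt_le hX1 hX_pos (half_pos hε)
    refine ⟨K₁ + K₂, fun n u ↦ ?_⟩
    have hsub : P.real {ω | firstPassageTime (reflectedProcess X Y) u ω < n ∧
        Y n ω ≤ u - (K₁ + K₂)} ≤
        P.real ({ω | ∃ s ≤ (n : ℝ≥0), Y n ω - X n ω - (Y s ω - X s ω) < -K₁} ∪
          {ω | ∃ s ≤ (n : ℝ≥0), X n ω - X s ω < -K₂}) := by
      refine ENNReal.toReal_mono (measure_ne_top _ _) (measure_mono_ae ?_)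
      filter_upwards [hX.cadlag, hY.cadlag] with ω hXω hYω
      rintro ⟨hτ, hle⟩
      obtain ⟨s, hsn, hus⟩ := firstPassageTime_lt_iff (t := n).1 hτ
      obtain ⟨r, hrs, hur⟩ := (lt_reflectedProcess_iff hXω hYω).1 hus
      by_cases h : Y n ω - X n ω - (Y r ω - X r ω) < -K₁
      · exact Or.inl ⟨r, hrs.trans hsn.le, h⟩
      -- Write `Y n = X n - Z n`. Since `-Z n ≥ -Z r - K₁` and `X s - Z r > u`, the bound on `Y n`
      -- again forces `X` to drop by more than `K₂` after `s`.
      · exact Or.inr ⟨s, hsn.le, by linarith⟩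
    refine (hsub.trans (measureReal_union_le _ _)).trans ?_
    linarith [(hK₁ n).2, (hK₂ n).2]

theorem IsApproxPassageTime.limit_theorems {W : ℝ≥0 → Ω → ℝ} {τ : ℝ → Ω → ℝ≥0∞}
    (h : IsApproxPassageTime (fun n : ℕ ↦ W n) τ P) (hW : IsLevyProcess W P)
    (hW1 : Integrable (W 1) P) {m : ℝ} (hm : m = ∫ ω, W 1 ω ∂P) (hpos : 0 < m)
    (hτ : ∀ u, AEMeasurable (τ u) P) :
    (∀ u, AEMeasurable (τ u) P ∧ ∀ᵐ ω ∂P, τ u ω < ∞) ∧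
      TendstoInMeasure P (fun (u : ℝ) ω ↦ (τ u ω).toReal / u) atTop (fun _ ↦ 1 / m) ∧
      (MemLp (W 1) 2 P →
        TendstoInDistribution (fun (u : ℝ) ω ↦ ((τ u ω).toReal - u / m) / √u) atTop
          (id : ℝ → ℝ) (fun _ ↦ P) (gaussianReal 0 (Var[W 1; P] / m ^ 3).toNNReal)) := by
  have hlln := hW.tendsto_div_ae hW1
  rw [← hm] at hlln
  have hfin := h.ae_lt_top hpos hlln
  refine ⟨fun u ↦ ⟨hτ u, hfin.mono fun ω hω ↦ hω u⟩,
    h.tendstoInMeasure_div hpos (fun n ↦ (hW.measurable n).aemeasurable) hlln, fun hW2 ↦ ?_⟩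
  have hclt := hW.tendstoInDistribution hW2
  rw [← hm] at hclt
  exact h.tendstoInDistribution hpos hτ hfin hclt

end Reflected

theorem mainTheorem1 {Ω : Type*} [MeasurableSpace Ω] (P : Measure Ω) [IsProbabilityMeasure P]
    (X Y : ℝ≥0 → Ω → ℝ) (hX : IsLevyProcess X P) (hY : IsLevyProcess Y P)
    (hXY : IndepFun (fun ω t ↦ X t ω) (fun ω t ↦ Y t ω) P)
    (hX1 : Integrable (X 1) P) (hY1 : Integrable (Y 1) P)
    (mX mY : ℝ) (hmX : mX = ∫ ω, X 1 ω ∂P) (hmY : mY = ∫ ω, Y 1 ω ∂P)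
    (hmX_pos : 0 < mX)
    (τ : ℝ → Ω → ℝ≥0∞) (hτ : τ = firstPassageTime (reflectedProcess X Y)) :
    (0 < ∫ ω, (X 1 ω - Y 1 ω) ∂P →
      (∀ u, AEMeasurable (τ u) P ∧ ∀ᵐ ω ∂P, τ u ω < ∞) ∧
      TendstoInMeasure P (fun (u : ℝ) ω ↦ (τ u ω).toReal / u) atTop (fun _ ↦ 1 / mX) ∧
      (MemLp (X 1) 2 P →
        TendstoInDistribution (fun (u : ℝ) ω ↦ ((τ u ω).toReal - u / mX) / √u) atTop
          (id : ℝ → ℝ) (fun _ ↦ P) (gaussianReal 0 (Var[X 1; P] / mX ^ 3).toNNReal))) ∧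
    (∫ ω, (X 1 ω - Y 1 ω) ∂P < 0 →
      (∀ u, AEMeasurable (τ u) P ∧ ∀ᵐ ω ∂P, τ u ω < ∞) ∧
      TendstoInMeasure P (fun (u : ℝ) ω ↦ (τ u ω).toReal / u) atTop (fun _ ↦ 1 / mY) ∧
      (MemLp (Y 1) 2 P →
        TendstoInDistribution (fun (u : ℝ) ω ↦ ((τ u ω).toReal - u / mY) / √u) atTop
          (id : ℝ → ℝ) (fun _ ↦ P) (gaussianReal 0 (Var[Y 1; P] / mY ^ 3).toNNReal))) := by
  have hm := aemeasurable_firstPassageTime_reflectedProcess hX.measurable hY.measurable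
    hX.cadlag hY.cadlag
  subst hτ
  have hX_pos : 0 < ∫ ω, X 1 ω ∂P := hmX ▸ hmX_pos
  refine ⟨fun hZ ↦ ?_, fun hZ ↦ ?_⟩
  · exact (isApproxPassageTime_of_integral_sub_pos hX hY hXY hX1 hY1 hX_pos hZ).limit_theorems
      hX hX1 hmX hmX_pos hm
  · rw [integral_sub hX1 hY1, ← hmX, ← hmY] at hZ
    -- Positivity of `mY` comes from `mY > mX > 0`.
    refine (isApproxPassageTime_of_integral_sub_neg hX hY hXY hX1 hY1 hX_pos ?_).limit_theorems
      hY hY1 hmY (by linarith) hm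
    rw [integral_sub hY1 hX1, ← hmX, ← hmY]
    linarith
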